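/- **Abstract data types.** An abstract data type (ADT) is $T=(\Sigma_i,\Sigma_o,Q,q_0,\delta,\lambda)$ with countable sets $\Sigma_i$ (inputs), $\Sigma_o$ (outputs), $Q$ (states), an initial state $q_0\in Q$, and total functions $\delta:Q\times\Sigma_i\to Q$, $\lambda:Q\times\Sigma_i\to\Sigma_o$. An infinite sequence $(\sigma_i^j/\sigma_o^j)_{j\in\mathbb N}$ is recognized by $T$ if there are states $q^0=q_0,q^1,\dots$ with $\delta(q^j,\sigma_i^j)=q^{j+1}$ and $\lambda(q^j,\sigma_i^j)=\sigma_o^j$ for all $j$. $L(T)$ is the set of all finite or infinite words $u$ over $(\Sigma_i\times\Sigma_o)\cup\Sigma_i$ for which there is a recognized sequence with $u^j=\sigma_i^j/\sigma_o^j$ or $u^j=\sigma_i^j$ (a hidden operation) at every position $j$ of $u$. The window stream $\mathcal W_k$ has states $\mathbb N^k$, initial state $(0,\dots,0)$, inputs $r$ and $w(v)$ ($v\in\mathbb N$), with $\delta(q,w(v))=(q_2,\dots,q_k,v)$, $\delta(q,r)=q$, $\lambda(q,w(v))=\bot$, $\lambda(q,r)=q$. The array $\mathcal W_k^K$ consists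 of $K$ independent copies of $\mathcal W_k$; each of its operations acts on one copy $x\in\{0,\dots,K-1\}$. **Causal consistency.** A history is $H=(\Sigma,E,\Lambda,\mapsto)$ with countably many events $E$, labels $\Lambda(e)\in\Sigma$ that are operations $\sigma_i/\sigma_o$ or hidden operations $\sigma_i$, and a partial order $\mapsto$ on $E$ (the program order) in which every event has a finite past. Its processes are the maximal chains of $\mapsto$. A linearization of a history is the word of the labels of all its events, listed in an order consistent with its order. A causal order is a partial order $\to$ on $E$ that contains $\mapsto$ and such that $\{e' : e\not\to e'\}$ is finite for every $e\in E$. $H$ is causally consistent for $T$ if there is a causal order $\to$ such that for every process $p$ and every $e\in p$, the history with the events $\lfloor e\rfloor=\{e':e'\to e\}$ ordered by $\to$, in which the return values of the events not in $p$ are hidden, has a linearization that belongs to $L(T)$. **System.** $n$ asynchronous sequential processes take steps one at a time; any number of them may crash (a process that crashes behaves correctly until then, and takes no step afterwards). They communicate by a reliable causal broadcast: a received message was broadcast before; no process receives the same message twice; a message received by some process is eventually received by all processes that never crash; after broadcasting a message a process takes no other step before it receives this message, except that it may crash; a process that never crashes does receive its own messages; and if a process broadcasts $m$ after having received $m'$,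 then every process that receives $m$ has received $m'$ before. **Algorithm.** Each process $p_i$ holds an array $str_i\in\mathbb N^{K\times k}$, initially $0$. A call $read(x)$ returns $str_i[x]$. A call $write(x,v)$ broadcasts $Mess(x,v)$, and then returns (with value $\bot$). On receipt of $Mess(x,v)$, $p_i$ executes $str_i[x][y]\leftarrow str_i[x][y+1]$ for $y=0,\dots,k-2$ and then $str_i[x][k-1]\leftarrow v$. **Admitted histories.** The history of a (finite or infinite) execution has as events all the calls, except the writes that never return and whose message is received by no process. A call is labelled by its input and its return value, or by its input alone if it never returns. For two events, $e\mapsto e'$ if they are calls of the same process and $e=e'$ or $e$ was made before $e'$. A history is admitted by the algorithm if it is the history of some execution. **Proposition.** For all $n,K,k\in\mathbb N$, every history admitted by the algorithm with $n$ processes is causally consistent for the array $\mathcal W_k^K$ of $K$ window streams of size $k$. -/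

import Mathlib

namespace CausalConsistency

/-! ## Abstract data types and sequential specifications -/

/-- An abstract data type with input alphabet `I` and output alphabet `O`. -/
structure ADT (I O : Type) where
  /-- the states -/
  Q : Type
  countable_input : Countable I
  countable_output : Countable O
  countable_states : Countable Q
  /-- the initial state -/
  init : Q
  /-- the transition function -/
  next : Q → I → Q
  /-- the output function -/
  out : Q → I → O

/-- An element of `(I × O) ∪ I`: an operation with its return value, or a hidden operation. -/
inductive Operation (I O : Type) where
  | full (i : I) (o : O)
  | hidden (i : I)

/-- Hide the return value of an operation. -/
def Operation.hide {I O : Type} : Operation I O → Operation I O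
  | .full i _ => .hidden i
  | .hidden i => .hidden i

/-- A finite or infinite sequence, indexed by the `j : ℕ` with `j < len`. -/
structure Word (α : Type) where
  len : ℕ∞
  get : (j : ℕ) → (j : ℕ∞) < len → α

/-- Apply a function to every letter of a word. -/
def Word.map {α β : Type} (f : α → β) (w : Word α) : Word β where
  len := w.len
  get j h := f (w.get j h)

/-- The infinite sequence of operations `σ` is recognized by `T`. -/
def ADT.Recognizes {I O : Type} (T : ADT I O) (σ : ℕ → I × O) : Prop :=
  ∃ q : ℕ → T.Q, q 0 = T.init ∧
    ∀ j, T.next (q j) (σ j).1 = q (j + 1) ∧ T.out (q j) (σ j).1 = (σ j).2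

/-- The sequential specification `L(T)`: the finite or infinite words which, letter by letter,
agree with a recognized infinite sequence, up to hiding some return values. -/
def ADT.seqSpec {I O : Type} (T : ADT I O) : Set (Word (Operation I O)) :=
  {u | ∃ σ : ℕ → I × O, T.Recognizes σ ∧ ∀ (j : ℕ) (h : (j : ℕ∞) < u.len),
    u.get j h = .full (σ j).1 (σ j).2 ∨ u.get j h = .hidden (σ j).1}

/-! ## Distributed histories -/

/-- A distributed history: countably many events, labelled by operations and partially ordered by
a (reflexive) program order in which every event has a finite past. -/
structure History (I O : Type) where
  E : Type
  countable_events : Countable E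
  label : E → Operation I O
  po : E → E → Prop
  po_refl : ∀ e, po e e
  po_trans : ∀ a b c, po a b → po b c → po a c
  po_antisymm : ∀ a b, po a b → po b a → a = b
  finite_past : ∀ e, {e' | po e' e}.Finite

namespace History

variable {I O : Type}

/-- The words that list the events of `H` in an order consistent with the program order. Since the
program order is reflexive, no event is listed twice. -/
def lin (H : History I O) : Set (Word (Operation I O)) :=
  {u | ∃ w : Word H.E, u = w.map H.label ∧
    (∀ e, ∃ (j : ℕ) (h : (j : ℕ∞) < w.len), w.get j h = e) ∧
    ∀ (i j : ℕ) (hi : (i : ℕ∞) < w.len) (hj : (j : ℕ∞) < w.len), i < j →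
      ¬ H.po (w.get j hj) (w.get i hi)}

open Classical in
/-- The projection `H.π(A, B)`: keep the events of `A`, hide the outputs of those not in `B`. -/
noncomputable def proj (H : History I O) (A B : Set H.E) : History I O where
  E := A
  countable_events := by
    have := H.countable_events
    exact inferInstance
  label e := if (e : H.E) ∈ B then H.label e else (H.label e).hide
  po a b := H.po a b
  po_refl e := H.po_refl e
  po_trans a b c := H.po_trans a b c
  po_antisymm a b h h' := Subtype.ext (H.po_antisymm a b h h')
  finite_past e := (H.finite_past e).preimage Subtype.val_injective.injOn

/-- `r` is a causal order for `H`: a partial order on the events which contains the program order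
and in which every event precedes all but finitely many events. -/
structure IsCausalOrder (H : History I O) (r : H.E → H.E → Prop) : Prop where
  refl : ∀ e, r e e
  trans : ∀ a b c, r a b → r b c → r a c
  antisymm : ∀ a b, r a b → r b a → a = b
  contains_po : ∀ a b, H.po a b → r a b
  cofinite : ∀ e, {e' | ¬ r e e'}.Finite

/-- In a causal order every event has a finite past. -/
theorem IsCausalOrder.finite_past {H : History I O} {r : H.E → H.E → Prop}
    (hr : H.IsCausalOrder r) (e : H.E) : {e' | r e' e}.Finite := by
  refine ((hr.cofinite e).union (Set.finite_singleton e)).subset ?_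
  intro e' he'
  by_cases h : r e e'
  · exact Or.inr (hr.antisymm e' e he' h)
  · exact Or.inl h

/-- The history with the events and labels of `H`, ordered by the causal order `r`. -/
def withOrder (H : History I O) (r : H.E → H.E → Prop) (hr : H.IsCausalOrder r) :
    History I O where
  E := H.E
  countable_events := H.countable_events
  label := H.label
  po := r
  po_refl := hr.refl
  po_trans := hr.trans
  po_antisymm := hr.antisymm
  finite_past := hr.finite_past

end History

/-- The set `CC(T)` of the histories that are causally consistent for `T`. The processes of a
history are the maximal chains of its program order. -/
def CC {I O : Type} (T : ADT I O) : Set (History I O) :=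
  {H | ∃ (r : H.E → H.E → Prop) (hr : H.IsCausalOrder r),
    ∀ p : Set H.E, IsMaxChain H.po p → ∀ e ∈ p,
      (((H.withOrder r hr).proj {e' | r e' e} p).lin ∩ T.seqSpec).Nonempty}

/-! ## Arrays of window streams -/

/-- The methods of a window stream. -/
inductive WInput where
  | read
  | write (v : ℕ)

theorem WInput.countable : Countable WInput := by
  refine Function.Injective.countable (β := Option ℕ)
    (f := fun i => match i with | .read => none | .write v => some v) ?_
  intro a b h
  cases a <;> cases b <;> simp_all

/-- The window stream of size `k`. An output is `none` (standing for the symbol `⊥`) or a tuple. -/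
def windowStream (k : ℕ) : ADT WInput (Option (Fin k → ℕ)) where
  Q := Fin k → ℕ
  countable_input := WInput.countable
  countable_output := inferInstance
  countable_states := inferInstance
  init := fun _ => 0
  next q i := match i with
    | .read => q
    | .write v => fun j => if h : (j : ℕ) + 1 < k then q ⟨j + 1, h⟩ else v
  out q i := match i with
    | .read => some q
    | .write _ => none

/-- The array of `K` independent instances of `T`, accessed by one method of one instance at
a time. -/
def ADT.array {I O : Type} (T : ADT I O) (K : ℕ) : ADT (Fin K × I) O where
  Q := Fin K → T.Q
  countable_input := by
    have := T.countable_input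
    exact inferInstance
  countable_output := T.countable_output
  countable_states := by
    have := T.countable_states
    exact inferInstance
  init := fun _ => T.init
  next q i := Function.update q i.1 (T.next (q i.1) i.2)
  out q i := T.out (q i.1) i.2

/-! ## The algorithm -/

/-- The content `Mess(x, v)` of a message. -/
structure Msg (K : ℕ) where
  x : Fin K
  v : ℕ

/-- One step of a process. In `recv m b` the number `b` identifies the message: it is the instant
at which the message was broadcast (two messages may have the same content). -/
inductive Action (K k : ℕ) where
  | call (c : Fin K × WInput)
  | bcast (m : Msg K)
  | recv (m : Msg K) (b : ℕ)
  | ret (o : Option (Fin k → ℕ))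
  | crash

/-- The control state of a process: no call in progress, inside a call before its broadcast or
return, inside a write after its broadcast, crashed. -/
inductive Control (K : ℕ) where
  | idle
  | inCall (c : Fin K × WInput)
  | sent
  | crashed

/-- The local state of a process; `str` is the variable of the algorithm. -/
structure LocalState (K k : ℕ) where
  str : Fin K → Fin k → ℕ
  ctrl : Control K

/-- The assignment `s[y] ← s[y + 1]`. -/
def shiftCell {k : ℕ} (s : Fin k → ℕ) (y : ℕ) : Fin k → ℕ :=
  if h : y + 1 < k then Function.update s ⟨y, Nat.lt_of_succ_lt h⟩ (s ⟨y + 1, h⟩) else s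

/-- The assignment `s[k - 1] ← v`. -/
def setLast {k : ℕ} (s : Fin k → ℕ) (v : ℕ) : Fin k → ℕ :=
  if h : 0 < k then Function.update s ⟨k - 1, Nat.sub_lt h Nat.one_pos⟩ v else s

/-- The code run on receipt of a message: `for y ∈ [0, k - 2]` do `str[x][y] ← str[x][y + 1]`, then
`str[x][k - 1] ← v`. -/
def onReceive {K k : ℕ} (str : Fin K → Fin k → ℕ) (m : Msg K) : Fin K → Fin k → ℕ :=
  Function.update str m.x (setLast ((List.range (k - 1)).foldl shiftCell (str m.x)) m.v)

/-- The steps of a process running the algorithm. -/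
inductive LocalStep {K k : ℕ} : LocalState K k → Action K k → LocalState K k → Prop where
  | call (str : Fin K → Fin k → ℕ) (c : Fin K × WInput) :
      LocalStep ⟨str, .idle⟩ (.call c) ⟨str, .inCall c⟩
  | readRet (str : Fin K → Fin k → ℕ) (x : Fin K) :
      LocalStep ⟨str, .inCall (x, .read)⟩ (.ret (some (str x))) ⟨str, .idle⟩
  | writeBcast (str : Fin K → Fin k → ℕ) (x : Fin K) (v : ℕ) :
      LocalStep ⟨str, .inCall (x, .write v)⟩ (.bcast ⟨x, v⟩) ⟨str, .sent⟩
  | writeRet (str : Fin K → Fin k → ℕ) :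
      LocalStep ⟨str, .sent⟩ (.ret none) ⟨str, .idle⟩
  | recv (str : Fin K → Fin k → ℕ) (a : Control K) (m : Msg K) (b : ℕ) (ha : a ≠ .crashed) :
      LocalStep ⟨str, a⟩ (.recv m b) ⟨onReceive str m, a⟩
  | crash (str : Fin K → Fin k → ℕ) (a : Control K) (ha : a ≠ .crashed) :
      LocalStep ⟨str, a⟩ .crash ⟨str, .crashed⟩

/-! ## Executions in the message-passing system -/

/-- A sequence of steps of `n` processes: at every instant at most one process takes a step.
Finite executions are those that have no step from some instant on. -/
abbrev Trace (n K k : ℕ) := ℕ → Option (Fin n × Action K k)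

/-- A faulty process is one that crashes. -/
def Trace.Faulty {n K k : ℕ} (s : Trace n K k) (i : Fin n) : Prop :=
  ∃ t, s t = some (i, .crash)

/-- The reliable causal broadcast. -/
structure Trace.IsReliableCausal {n K k : ℕ} (s : Trace n K k) : Prop where
  /-- A message that is received was broadcast before. -/
  validity : ∀ t i m b, s t = some (i, .recv m b) → b < t ∧ ∃ j, s b = some (j, .bcast m)
  /-- No process receives a message twice. -/
  no_duplication : ∀ t t' i m m' b,
    s t = some (i, .recv m b) → s t' = some (i, .recv m' b) → t = t'
  /-- A message received by some process is eventually received by all non-faulty processes. -/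
  agreement : ∀ t i m b, s t = some (i, .recv m b) →
    ∀ j, ¬ s.Faulty j → ∃ t', s t' = some (j, .recv m b)
  /-- After a broadcast, a process does nothing but crash before it receives its message. -/
  local_receipt : ∀ b i m, s b = some (i, .bcast m) → ∀ t a, b < t → s t = some (i, a) →
    a = .crash ∨ ∃ t', b < t' ∧ t' ≤ t ∧ s t' = some (i, .recv m b)
  /-- A non-faulty process receives its own messages. -/
  own_receipt : ∀ b i m, s b = some (i, .bcast m) → ¬ s.Faulty i →
    ∃ t, b < t ∧ s t = some (i, .recv m b)
  /-- If a process broadcasts `m` after having received `m'`, then every process that receives `m`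
  has received `m'` before. -/
  causality : ∀ i m' b' t' m b,
    s t' = some (i, .recv m' b') → s b = some (i, .bcast m) → t' < b →
      ∀ j t, s t = some (j, .recv m b) → ∃ t'', t'' < t ∧ s t'' = some (j, .recv m' b')

/-- An execution of the algorithm by `n` asynchronous processes over a reliable causal broadcast,
with any number of crashes. -/
structure Run (n K k : ℕ) where
  step : Trace n K k
  /-- the local states just before each instant -/
  state : ℕ → Fin n → LocalState K k
  init : ∀ i, state 0 i = ⟨fun _ _ => 0, .idle⟩
  acts : ∀ t i a, step t = some (i, a) → LocalStep (state t i) a (state (t + 1) i)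
  frame : ∀ t i, (∀ a, step t ≠ some (i, a)) → state (t + 1) i = state t i
  broadcast : step.IsReliableCausal

namespace Run

variable {n K k : ℕ} (R : Run n K k)

/-- The call made by process `i` at instant `t` returns `o`: this is the first value returned by
`i` after `t`. -/
def Returns (i : Fin n) (t : ℕ) (o : Option (Fin k → ℕ)) : Prop :=
  ∃ t', t < t' ∧ R.step t' = some (i, .ret o) ∧
    ∀ s, t < s → s < t' → ∀ o', R.step s ≠ some (i, .ret o')

/-- The message broadcast within the call made by process `i` at instant `t`, that is after `t`
and before the next call of `i`, is received by some process. -/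
def MessageReceived (i : Fin n) (t : ℕ) : Prop :=
  ∃ b m, t < b ∧ R.step b = some (i, .bcast m) ∧
    (∀ s, t < s → s < b → ∀ c, R.step s ≠ some (i, .call c)) ∧
    ∃ t' j, R.step t' = some (j, .recv m b)

/-- The events of an execution: all the calls, except the writes that were cut short (they never
return) before any process received their message, and so have no effect at all. -/
structure Event where
  pid : Fin n
  input : Fin K × WInput
  time : ℕ
  is_call : R.step time = some (pid, .call input)
  effective : (∃ v, input.2 = .write v) → (∃ o, R.Returns pid time o) ∨ R.MessageReceived pid time

theorem Event.eq_of_time {R : Run n K k} {e e' : R.Event} (h : e.time = e'.time) : e = e' := by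
  obtain ⟨i, c, t, hc, _⟩ := e
  obtain ⟨i', c', t', hc', _⟩ := e'
  simp only at h
  subst h
  rw [hc] at hc'
  simp only [Option.some.injEq, Prod.mk.injEq, Action.call.injEq] at hc'
  obtain ⟨rfl, rfl⟩ := hc'
  rfl

open Classical in
/-- The history of an execution. A call that returned is labelled by its input and its return
value, a call that did not return by its input alone. The program order is the order of the calls
of each process. -/
noncomputable def history : History (Fin K × WInput) (Option (Fin k → ℕ)) where
  E := R.Event
  countable_events := Function.Injective.countable (f := fun e : R.Event => e.time)
    fun _ _ h => Event.eq_of_time h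
  label e := if h : ∃ o, R.Returns e.pid e.time o then .full e.input h.choose
    else .hidden e.input
  po e e' := e.pid = e'.pid ∧ e.time ≤ e'.time
  po_refl _ := ⟨rfl, le_rfl⟩
  po_trans _ _ _ h h' := ⟨h.1.trans h'.1, h.2.trans h'.2⟩
  po_antisymm _ _ h h' := Event.eq_of_time (le_antisymm h.2 h'.2)
  finite_past e := by
    refine Set.Finite.subset ((Set.finite_Iic e.time).preimage
      (f := fun e : R.Event => e.time) fun _ _ _ _ h => Event.eq_of_time h) ?_
    exact fun e' he' => he'.2

end Run

/-- The histories admitted by the algorithm with `n` processes. -/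
def admitted (n K k : ℕ) : Set (History (Fin K × WInput) (Option (Fin k → ℕ))) :=
  {H | ∃ R : Run n K k, H = R.history}

end CausalConsistency

namespace CausalConsistency

/-! ## The code run on receipt of a message -/

/-! Each call is given an instant at which it takes effect, its commit point: the broadcast of a
write, the return of a read, or the call itself for a read that never returns. Messages are named by
the instants of their broadcasts. The causal past of an event is the set of messages its process has
broadcast or received up to the commit point; one event precedes another if its causal past is
contained in the other's and its commit point is not later. Following messages alone would not do: a
read sends none, yet a causal order must put it before almost all events. The inclusion of pasts
achieves this (`isCausalOrder_causalOrder`): a causal past is finite, and by agreement its messages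
reach every process that does not crash. For an event of process `i`, the events before it are
listed by the first instant at which `i` knows their causal past (`rank`), ties being broken by
commit points. This extends the causal order (`key_le_of_causalOrder`) and lists the writes as `i`
receives them (`key_lt_of_receivedBefore`), since causal delivery makes the past of a message known
no later than the message. Hence the writes listed before a returning read of `i` are exactly those
received before its return, in the order of receipt, and replaying them yields the local array that
the read returns (`foldl_next_eq_str`). Outputs of other processes are hidden, and those of writes
are constant. -/

theorem foldl_shiftCell {k : ℕ} (s : Fin k → ℕ) (n : ℕ) (hn : n ≤ k - 1) (j : Fin k) :
    (List.range n).foldl shiftCell s j =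
      if h : (j : ℕ) < n then s ⟨j + 1, by omega⟩ else s j := by
  induction n generalizing j with
  | zero => simp
  | succ n ih =>
    rw [List.range_succ, List.foldl_append]
    have hk : n + 1 < k := by omega
    simp only [List.foldl_cons, List.foldl_nil, shiftCell, hk, dif_pos]
    by_cases hj : j = ⟨n, Nat.lt_of_succ_lt hk⟩
    -- Assignment `n` copies cell `n + 1`, which the earlier assignments have not touched.
    · subst hj
      rw [Function.update_self, ih (by omega)]
      simp
    · have hj' : (j : ℕ) ≠ n := fun h => hj (Fin.ext h)
      rw [Function.update_of_ne hj, ih (by omega)]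
      by_cases h : (j : ℕ) < n
      · rw [dif_pos h, dif_pos (by omega)]
      · rw [dif_neg h, dif_neg (by omega)]

theorem setLast_foldl_shiftCell {k : ℕ} (s : Fin k → ℕ) (v : ℕ) :
    setLast ((List.range (k - 1)).foldl shiftCell s) v = (windowStream k).next s (.write v) := by
  funext j
  have hk : 0 < k := j.pos
  simp only [setLast, hk, dif_pos, windowStream]
  by_cases hj : (j : ℕ) = k - 1
  · obtain rfl : j = ⟨k - 1, Nat.sub_lt hk Nat.one_pos⟩ := Fin.ext hj
    rw [Function.update_self, dif_neg (by simp; omega)]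
  · rw [Function.update_of_ne (fun h => hj (by rw [h])), foldl_shiftCell _ _ le_rfl]
    have := j.isLt
    rw [dif_pos (by omega), dif_pos (by omega)]

theorem onReceive_eq_next {K k : ℕ} (str : Fin K → Fin k → ℕ) (m : Msg K) :
    onReceive str m = ((windowStream k).array K).next str (m.x, .write m.v) := by
  simp only [onReceive, setLast_foldl_shiftCell]
  rfl

/-! ## Finite words of a sequential specification -/

/-- The finite word with the letters of a list. -/
def Word.ofList {α : Type} (l : List α) : Word α where
  len := l.length
  get j h := l[j]'(by exact_mod_cast h)

/-- A finite list of all the events of a history, in an order consistent with the program order,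
each label of which agrees with the output of the data type, is a linearization in `L(T)`. -/
theorem lin_inter_seqSpec_nonempty {I O : Type} (T : ADT I O) (H : History I O)
    (l : List H.E) (inp : H.E → I) (i₀ : I) (hmem : ∀ e, e ∈ l)
    (hpw : l.Pairwise fun a b => ¬ H.po b a)
    (hlab : ∀ l₁ e l₂, l = l₁ ++ e :: l₂ → H.label e = .hidden (inp e) ∨
      H.label e = .full (inp e) (T.out ((l₁.map inp).foldl T.next T.init) (inp e))) :
    (H.lin ∩ T.seqSpec).Nonempty := by
  refine ⟨(Word.ofList l).map H.label, ⟨Word.ofList l, rfl, ?_, ?_⟩, ?_⟩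
  · intro e
    obtain ⟨j, hj, rfl⟩ := List.getElem_of_mem (hmem e)
    exact ⟨j, by simpa [Word.ofList] using hj, rfl⟩
  · intro i j hi hj hij
    exact List.pairwise_iff_getElem.1 hpw i j _ _ hij
  -- A recognized sequence is infinite, so the inputs are padded with `i₀` after the end of the
  -- list; the outputs are those computed by `T`.
  · let a : ℕ → I := fun j => ((l.map inp)[j]?).getD i₀
    let q : ℕ → T.Q := fun j => Nat.rec T.init (fun j q => T.next q (a j)) j
    have hq : ∀ j, j ≤ l.length → q j = ((l.take j).map inp).foldl T.next T.init := by
      intro j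
      induction j with
      | zero => intro _; rfl
      | succ j ih =>
        intro hj
        have h1 : q (j + 1) = T.next (q j) (a j) := rfl
        have h2 : a j = inp l[j] := by simp [a, List.getElem?_eq_getElem (show j < l.length from hj)]
        rw [h1, ih (by omega), List.take_succ_eq_append_getElem hj, h2, List.map_append,
          List.foldl_append]
        rfl
    refine ⟨fun j => (a j, T.out (q j) (a j)), ⟨q, rfl, fun j => ⟨rfl, rfl⟩⟩, ?_⟩
    intro j h
    have hj : j < l.length := by simpa [Word.ofList, Word.map] using h
    have h2 : a j = inp l[j] := by simp [a, List.getElem?_eq_getElem hj]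
    have := hlab (l.take j) l[j] (l.drop (j + 1)) (by simp)
    rw [← hq j hj.le, ← h2] at this
    exact this.symm

namespace Run

variable {n K k : ℕ} (R : Run n K k)

/-! ## Control flow of a process -/

/-- Within a call, the control state tells how far the call has gone. -/
theorem ctrl_within_call {i : Fin n} {t : ℕ} {c : Fin K × WInput}
    (hc : R.step t = some (i, .call c)) {s : ℕ} (hts : t < s)
    (hno : ∀ u, t < u → u < s → ∀ c', R.step u ≠ some (i, .call c')) :
    ((R.state s i).ctrl = .inCall c ∧ ∀ b m, t < b → b < s → R.step b ≠ some (i, .bcast m)) ∨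
    ((R.state s i).ctrl = .sent ∧ ∃ x v b, c = (x, .write v) ∧ t < b ∧ b < s ∧
      R.step b = some (i, .bcast ⟨x, v⟩)) ∨
    ((R.state s i).ctrl = .idle ∧ ∃ r o, t < r ∧ r < s ∧ R.step r = some (i, .ret o)) ∨
    (R.state s i).ctrl = .crashed := by
  induction s, hts using Nat.le_induction with
  | base =>
    have L := R.acts _ _ _ hc
    generalize R.state t i = A at L
    generalize R.state (t + 1) i = B at L ⊢
    cases L
    refine Or.inl ⟨rfl, fun b m h h' => by omega⟩
  | succ s hs ih =>
    have hs : t < s := hs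
    specialize ih fun u h h' => hno u h (by omega)
    by_cases h : ∃ a, R.step s = some (i, a)
    · obtain ⟨a, ha⟩ := h
      have L := R.acts _ _ _ ha
      generalize R.state s i = A at L ih
      generalize R.state (s + 1) i = B at L
      cases L with
      | call str c' => exact absurd ha (hno s hs (by omega) c')
      | readRet str x => exact Or.inr (Or.inr (Or.inl ⟨rfl, s, _, hs, by omega, ha⟩))
      | writeBcast str x v =>
        simp only [reduceCtorEq, false_and, or_false, Control.inCall.injEq] at ih
        exact Or.inr (Or.inl ⟨rfl, x, v, s, ih.1.symm, hs, by omega, ha⟩)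
      | writeRet str => exact Or.inr (Or.inr (Or.inl ⟨rfl, s, _, hs, by omega, ha⟩))
      | recv str a m b hne =>
        rcases ih with ⟨h1, h2⟩ | ⟨h1, x, v, b', h2, h3, h4, h5⟩ | ⟨h1, r, o, h2, h3, h4⟩ | h1
        · refine Or.inl ⟨h1, fun b' m' hb hb' => ?_⟩
          rcases Nat.lt_succ_iff_lt_or_eq.1 hb' with hb' | rfl
          · exact h2 b' m' hb hb'
          · rw [ha]; simp
        · exact Or.inr (Or.inl ⟨h1, x, v, b', h2, h3, by omega, h5⟩)
        · exact Or.inr (Or.inr (Or.inl ⟨h1, r, o, h2, by omega, h4⟩))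
        · exact Or.inr (Or.inr (Or.inr h1))
      | crash str a hne => exact Or.inr (Or.inr (Or.inr rfl))
    · push Not at h
      rw [R.frame s i h]
      rcases ih with ⟨h1, h2⟩ | ⟨h1, x, v, b', h2, h3, h4, h5⟩ | ⟨h1, r, o, h2, h3, h4⟩ | h1
      · refine Or.inl ⟨h1, fun b' m' hb hb' => ?_⟩
        rcases Nat.lt_succ_iff_lt_or_eq.1 hb' with hb' | rfl
        · exact h2 b' m' hb hb'
        · exact h _
      · exact Or.inr (Or.inl ⟨h1, x, v, b', h2, h3, by omega, h5⟩)
      · exact Or.inr (Or.inr (Or.inl ⟨h1, r, o, h2, by omega, h4⟩))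
      · exact Or.inr (Or.inr (Or.inr h1))

theorem ctrl_of_call {i : Fin n} {t : ℕ} {c : Fin K × WInput}
    (h : R.step t = some (i, .call c)) : (R.state t i).ctrl = .idle := by
  have L := R.acts _ _ _ h
  generalize R.state t i = A at L
  generalize R.state (t + 1) i = B at L
  cases L
  rfl

theorem ctrl_of_bcast {i : Fin n} {t : ℕ} {m : Msg K} (h : R.step t = some (i, .bcast m)) :
    (R.state t i).ctrl = .inCall (m.x, .write m.v) := by
  have L := R.acts _ _ _ h
  generalize R.state t i = A at L
  generalize R.state (t + 1) i = B at L
  cases L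
  rfl

theorem ctrl_of_ret {i : Fin n} {t : ℕ} {o : Option (Fin k → ℕ)}
    (h : R.step t = some (i, .ret o)) :
    (∃ x, (R.state t i).ctrl = .inCall (x, .read) ∧ o = some ((R.state t i).str x)) ∨
      ((R.state t i).ctrl = .sent ∧ o = none) := by
  have L := R.acts _ _ _ h
  generalize R.state t i = A at L
  generalize R.state (t + 1) i = B at L
  cases L
  · exact Or.inl ⟨_, rfl, rfl⟩
  · exact Or.inr ⟨rfl, rfl⟩

/-- A process inside a call has made this call. -/
theorem exists_call {i : Fin n} {s : ℕ} {c : Fin K × WInput}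
    (h : (R.state s i).ctrl = .inCall c) : ∃ t, t < s ∧ R.step t = some (i, .call c) ∧
      ∀ u, t < u → u < s → ∀ c', R.step u ≠ some (i, .call c') := by
  induction s with
  | zero => rw [R.init] at h; cases h
  | succ s ih =>
    -- Shared by the two cases in which the control does not change: a receipt, and no step of `i`.
    have key : (R.state s i).ctrl = .inCall c → (∀ c', R.step s ≠ some (i, .call c')) →
        ∃ t, t < s + 1 ∧ R.step t = some (i, .call c) ∧
          ∀ u, t < u → u < s + 1 → ∀ c', R.step u ≠ some (i, .call c') := by
      intro h1 h2
      obtain ⟨t, ht, h3, h4⟩ := ih h1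
      refine ⟨t, by omega, h3, fun u hu hu' => ?_⟩
      rcases Nat.lt_succ_iff_lt_or_eq.1 hu' with hu' | rfl
      · exact h4 u hu hu'
      · exact h2
    by_cases ha : ∃ a, R.step s = some (i, a)
    · obtain ⟨a, ha⟩ := ha
      have L := R.acts _ _ _ ha
      generalize R.state s i = A at L key
      generalize R.state (s + 1) i = B at L h
      cases L with
      | call str c' =>
        cases h
        exact ⟨s, by omega, ha, fun u hu hu' => by omega⟩
      | recv str a m b hne => exact key h fun c' => by rw [ha]; simp
      | readRet => cases h
      | writeBcast => cases h
      | writeRet => cases h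
      | crash => cases h
    · push Not at ha
      rw [R.frame s i ha] at h
      exact key h fun c' => ha _

/-- A crashed process makes no call. -/
theorem no_call_of_crash {i : Fin n} {t : ℕ} (h : R.step t = some (i, .crash)) {s : ℕ}
    (hts : t < s) (c : Fin K × WInput) : R.step s ≠ some (i, .call c) := by
  have key : (R.state s i).ctrl = .crashed := by
    induction s, hts using Nat.le_induction with
    | base =>
      have L := R.acts _ _ _ h
      generalize R.state t i = A at L
      generalize R.state (t + 1) i = B at L
      cases L
      rfl
    | succ s hs ih =>
      by_cases ha : ∃ a, R.step s = some (i, a)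
      · obtain ⟨a, ha⟩ := ha
        have L := R.acts _ _ _ ha
        generalize R.state s i = A at L ih
        generalize R.state (s + 1) i = B at L
        cases L <;> first | rfl | exact ih | cases ih
      · push Not at ha
        rw [R.frame s i ha]
        exact ih
  intro hs
  rw [R.ctrl_of_call hs] at key
  cases key

/-- A call does not return before the next call; a read returns the local value at that instant, a
write returns after its broadcast. -/
theorem Returns.spec {R : Run n K k} {i : Fin n} {t : ℕ} {c : Fin K × WInput}
    {o : Option (Fin k → ℕ)} (h : R.Returns i t o) (hc : R.step t = some (i, .call c)) :
    ∃ r, t < r ∧ R.step r = some (i, .ret o) ∧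
      (∀ u, t < u → u < r → ∀ c', R.step u ≠ some (i, .call c')) ∧
      ((∃ x, c = (x, .read) ∧ o = some ((R.state r i).str x)) ∨
        (o = none ∧ ∃ x v b, c = (x, .write v) ∧ t < b ∧ b < r ∧
          R.step b = some (i, .bcast ⟨x, v⟩))) := by
  obtain ⟨r, hr, hret, hfirst⟩ := h
  -- The first call made in between would find the control idle, so the call at `t` would have
  -- returned before it, and `r` would not be the first return.
  have hno : ∀ u, t < u → u < r → ∀ c', R.step u ≠ some (i, .call c') := by
    intro u
    induction u using Nat.strong_induction_on with
    | _ u ih =>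
      intro hu hur c' hcall
      have h1 := R.ctrl_of_call hcall
      have h2 := R.ctrl_within_call hc hu fun w hw hwu => ih w hwu hw (by omega)
      rw [h1] at h2
      simp only [reduceCtorEq, false_and, true_and, false_or, or_false] at h2
      obtain ⟨r', o', h3, h4, h5⟩ := h2
      exact hfirst r' h3 (by omega) o' h5
  refine ⟨r, hr, hret, hno, ?_⟩
  have h2 := R.ctrl_within_call hc hr hno
  rcases R.ctrl_of_ret hret with ⟨x, h1, ho⟩ | ⟨h1, ho⟩
  · rw [h1] at h2
    simp only [reduceCtorEq, false_and, or_false, Control.inCall.injEq] at h2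
    exact Or.inl ⟨x, h2.1.symm, ho⟩
  · rw [h1] at h2
    simp only [reduceCtorEq, false_and, true_and, false_or, or_false] at h2
    exact Or.inr ⟨ho, h2⟩

/-- There is at most one broadcast between a call and the next one. -/
theorem bcast_unique {i : Fin n} {t b b' : ℕ} {c : Fin K × WInput} {m m' : Msg K}
    (hc : R.step t = some (i, .call c)) (hb : t < b) (hbb : b ≤ b')
    (hno : ∀ u, t < u → u < b' → ∀ c', R.step u ≠ some (i, .call c'))
    (h : R.step b = some (i, .bcast m)) (h' : R.step b' = some (i, .bcast m')) : b = b' := by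
  by_contra hne
  have h2 := R.ctrl_within_call hc (by omega : t < b') hno
  rw [R.ctrl_of_bcast h'] at h2
  simp only [reduceCtorEq, false_and, or_false] at h2
  exact h2.2 b m hb (by omega) h

/-! ## Commit points -/

/-- The instant `τ` at which the call `e` is taken to happen: the broadcast of a write, the return of
a read, the call itself for a read which does not return. -/
structure IsCommit (e : R.Event) (τ : ℕ) : Prop where
  le : e.time ≤ τ
  lt_next : ∀ s c, e.time < s → R.step s = some (e.pid, .call c) → τ < s
  kind : (∃ x v, e.input = (x, .write v) ∧ R.step τ = some (e.pid, .bcast ⟨x, v⟩) ∧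
      ∃ j t, R.step t = some (j, .recv ⟨x, v⟩ τ)) ∨
    (∃ x, e.input = (x, .read) ∧ ((∃ o, R.step τ = some (e.pid, .ret o)) ∨
      ∃ c, R.step τ = some (e.pid, .call c)))
  returns : ∀ o, R.Returns e.pid e.time o →
    (∃ x, e.input = (x, .read) ∧ R.step τ = some (e.pid, .ret o) ∧
      o = some ((R.state τ e.pid).str x)) ∨ ((∃ x v, e.input = (x, .write v)) ∧ o = none)

theorem Returns.unique {R : Run n K k} {i : Fin n} {t : ℕ} {o o' : Option (Fin k → ℕ)}
    (h : R.Returns i t o) (h' : R.Returns i t o') : o = o' := by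
  obtain ⟨r, h1, h2, h3⟩ := h
  obtain ⟨r', h1', h2', h3'⟩ := h'
  rcases lt_trichotomy r r' with hlt | rfl | hlt
  · exact absurd h2 (h3' r h1 hlt o)
  · rw [h2] at h2'
    simpa using h2'
  · exact absurd h2' (h3 r' h1' hlt o')

/-- The point to prove is that the message of a write is received by someone: if the write returned,
its sender received it between broadcast and return; otherwise `effective` says so. -/
theorem exists_isCommit (e : R.Event) : ∃ τ, R.IsCommit e τ := by
  have hcall := e.is_call
  have lt_next : ∀ τ, e.time < τ →
      (∀ u, e.time < u → u < τ → ∀ c, R.step u ≠ some (e.pid, .call c)) →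
      (∀ c, R.step τ ≠ some (e.pid, .call c)) →
      ∀ s c, e.time < s → R.step s = some (e.pid, .call c) → τ < s := by
    intro τ _ h1 h2 s c hs hsc
    by_contra hlt
    rcases (not_lt.1 hlt).lt_or_eq with h | rfl
    · exact h1 s hs h c hsc
    · exact h2 c hsc
  rcases hin : e.input with ⟨x, _ | v⟩
  · by_cases hr : ∃ o, R.Returns e.pid e.time o
    · obtain ⟨o, ho⟩ := hr
      obtain ⟨r, h1, h2, h3, h4⟩ := ho.spec hcall
      refine ⟨r, h1.le, lt_next r h1 h3 fun c => by rw [h2]; simp,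
        Or.inr ⟨x, hin, Or.inl ⟨o, h2⟩⟩, fun o' ho' => Or.inl ⟨x, hin, ?_⟩⟩
      obtain rfl := ho.unique ho'
      rw [hin] at h4
      simp only [Prod.mk.injEq, reduceCtorEq, and_false, false_and, exists_false, or_false,
        and_true] at h4
      obtain ⟨x', rfl, h5⟩ := h4
      exact ⟨h2, h5⟩
    · exact ⟨e.time, le_rfl, fun s c h _ => h, Or.inr ⟨x, hin, Or.inr ⟨_, hcall⟩⟩,
        fun o ho => absurd ⟨o, ho⟩ hr⟩
  · have returns : ∀ o, R.Returns e.pid e.time o → o = none := by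
      intro o ho
      obtain ⟨r, h1, h2, h3, h4⟩ := ho.spec hcall
      rw [hin] at h4
      simpa using h4.resolve_left (by simp)|>.1
    suffices h : ∃ b j t, e.time < b ∧
        (∀ u, e.time < u → u < b → ∀ c, R.step u ≠ some (e.pid, .call c)) ∧
        R.step b = some (e.pid, .bcast ⟨x, v⟩) ∧ R.step t = some (j, .recv ⟨x, v⟩ b) by
      obtain ⟨b, j, t, h1, h2, h3, h4⟩ := h
      exact ⟨b, h1.le, lt_next b h1 h2 fun c => by rw [h3]; simp,
        Or.inl ⟨x, v, hin, h3, j, t, h4⟩, fun o ho => Or.inr ⟨⟨x, v, hin⟩, returns o ho⟩⟩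
    rcases e.effective ⟨v, by rw [hin]⟩ with ⟨o, ho⟩ | ⟨b, m, h1, h2, h3, t, j, h4⟩
    · obtain ⟨r, h1, h2, h3, h4⟩ := ho.spec hcall
      rw [hin] at h4
      obtain ⟨-, x', v', b, h5, h6, h7, h8⟩ := h4.resolve_left (by simp)
      simp only [Prod.mk.injEq, WInput.write.injEq] at h5
      obtain ⟨rfl, rfl⟩ := h5
      obtain ⟨t, -, -, h9⟩ :=
        (R.broadcast.local_receipt b e.pid _ h8 r _ h7 h2).resolve_left (by simp)
      exact ⟨b, e.pid, t, h6, fun u h h' => h3 u h (by omega), h8, h9⟩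
    · have h5 := R.ctrl_within_call hcall h1 h3
      rw [R.ctrl_of_bcast h2] at h5
      simp only [reduceCtorEq, false_and, or_false, Control.inCall.injEq, hin, Prod.mk.injEq,
        WInput.write.injEq] at h5
      obtain ⟨⟨rfl, rfl⟩, -⟩ := h5
      exact ⟨b, j, t, h1, h3, h2, h4⟩

/-- The commit point of a call. -/
noncomputable def commit (e : R.Event) : ℕ := (R.exists_isCommit e).choose

theorem isCommit_commit (e : R.Event) : R.IsCommit e (R.commit e) :=
  (R.exists_isCommit e).choose_spec

/-- Steps of this kind are those at which a process has received every message it knows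
(`exists_recv_of_mem_known`). -/
theorem exists_step_commit (e : R.Event) :
    ∃ a, R.step (R.commit e) = some (e.pid, a) ∧ a ≠ .crash ∧ ∀ m b, a ≠ .recv m b := by
  rcases (R.isCommit_commit e).kind with ⟨x, v, -, h, -⟩ | ⟨x, -, ⟨o, h⟩ | ⟨c, h⟩⟩ <;>
    exact ⟨_, h, by simp, by simp⟩

theorem commit_lt_commit {e e' : R.Event} (hp : e.pid = e'.pid) (ht : e.time < e'.time) :
    R.commit e < R.commit e' :=
  ((R.isCommit_commit e).lt_next _ _ ht (hp ▸ e'.is_call)).trans_le (R.isCommit_commit e').le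

/-- One process moves at each instant, so equal commit points belong to one process, where they are
ordered as the calls. -/
theorem commit_injective : Function.Injective R.commit := by
  intro e e' h
  obtain ⟨a, ha, -⟩ := R.exists_step_commit e
  obtain ⟨a', ha', -⟩ := R.exists_step_commit e'
  rw [h, ha'] at ha
  have hp : e.pid = e'.pid := by simp at ha; exact ha.1.symm
  rcases lt_trichotomy e.time e'.time with ht | ht | ht
  · exact absurd h (R.commit_lt_commit hp ht).ne
  · exact Event.eq_of_time ht
  · exact absurd h.symm (R.commit_lt_commit hp.symm ht).ne

/-- Every broadcast of a message that is received is the commit point of a write. -/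
theorem exists_event_of_recv {t : ℕ} {j : Fin n} {m : Msg K} {b : ℕ}
    (h : R.step t = some (j, .recv m b)) : ∃ e : R.Event, R.commit e = b := by
  obtain ⟨-, i, hb⟩ := R.broadcast.validity t j m b h
  obtain ⟨s, hs, hcall, hno⟩ := R.exists_call (R.ctrl_of_bcast hb)
  let e : R.Event := ⟨i, _, s, hcall, fun _ => Or.inr ⟨b, m, hs, hb, hno, t, j, h⟩⟩
  refine ⟨e, ?_⟩
  -- `commit e` comes from a choice, so it has to be identified with `b`: both are broadcasts
  -- between the same call and the next one.
  have hC := R.isCommit_commit e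
  rcases hC.kind with ⟨x, v, -, h1, -⟩ | ⟨x, h1, -⟩
  · have hlt : s < R.commit e := by
      refine lt_of_le_of_ne hC.le fun heq => ?_
      rw [← show s = R.commit e from heq, hcall] at h1
      simp at h1
    rcases le_total (R.commit e) b with hle | hle
    · exact R.bcast_unique hcall hlt hle hno h1 hb
    · refine (R.bcast_unique hcall hs hle (fun u hu hub c hc => ?_) hb h1).symm
      exact absurd (hC.lt_next u c hu hc) (by omega)
  · cases h1

/-! ## Messages known to a process -/

/-- At instant `s`, process `i` broadcasts or receives the message broadcast at instant `b`. -/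
def Learns (i : Fin n) (s b : ℕ) : Prop :=
  (∃ m, R.step s = some (i, .recv m b)) ∨ (s = b ∧ ∃ m, R.step b = some (i, .bcast m))

/-- The messages broadcast or received by process `i` before instant `t`. -/
def known (i : Fin n) (t : ℕ) : Set ℕ := {b | ∃ s, s < t ∧ R.Learns i s b}

theorem known_mono (i : Fin n) : Monotone (R.known i) :=
  fun _ _ h _ ⟨s, hs, hb⟩ => ⟨s, hs.trans_le h, hb⟩

theorem lt_of_mem_known {R : Run n K k} {i : Fin n} {t b : ℕ} (h : b ∈ R.known i t) : b < t := by
  obtain ⟨s, hs, ⟨m, h⟩ | ⟨rfl, -⟩⟩ := h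
  · exact (R.broadcast.validity s i m b h).1.trans hs
  · exact hs

theorem finite_known (i : Fin n) (t : ℕ) : (R.known i t).Finite :=
  (Set.finite_Iio t).subset fun _ h => lt_of_mem_known h

/-- After its broadcast, a message is received by its sender before any other step but a crash. -/
theorem exists_recv_of_bcast {i : Fin n} {b t : ℕ} {m : Msg K} {a : Action K k}
    (hb : R.step b = some (i, .bcast m)) (hbt : b < t) (ht : R.step t = some (i, a))
    (ha : a ≠ .crash) : ∃ s, b < s ∧ s ≤ t ∧ R.step s = some (i, .recv m b) :=
  (R.broadcast.local_receipt b i m hb t a hbt ht).resolve_left ha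

/-- A process which takes a step has received all the messages it knows. -/
theorem exists_recv_of_mem_known {i : Fin n} {b t : ℕ} {a : Action K k} (hb : b ∈ R.known i t)
    (ht : R.step t = some (i, a)) (ha : a ≠ .crash) (ha' : ∀ m b, a ≠ .recv m b) :
    ∃ s m, s < t ∧ R.step s = some (i, .recv m b) := by
  obtain ⟨s, hs, ⟨m, h⟩ | ⟨rfl, m, h⟩⟩ := hb
  · exact ⟨s, m, hs, h⟩
  · obtain ⟨u, -, hut, hu⟩ := R.exists_recv_of_bcast h hs ht ha
    rcases hut.lt_or_eq with hut | rfl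
    · exact ⟨u, m, hut, hu⟩
    · rw [ht] at hu
      simp only [Option.some.injEq, Prod.mk.injEq, true_and] at hu
      exact absurd hu (ha' _ _)

/-- A process which knows a message knows all those that its sender knew. -/
theorem known_subset_known {i j : Fin n} {b t : ℕ} {m : Msg K} (hb : b ∈ R.known i t)
    (hj : R.step b = some (j, .bcast m)) : R.known j (b + 1) ⊆ R.known i t := by
  obtain ⟨s, hs, ⟨m', h⟩ | ⟨rfl, m', h⟩⟩ := hb
  · obtain ⟨hbs, i', hi'⟩ := R.broadcast.validity s i m' b h
    obtain rfl : m = m' := by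
      rw [hj] at hi'
      simp at hi'
      exact hi'.2
    rintro c ⟨u, hu, hc⟩
    -- By causality, `i` received before `m` whatever `j` received before broadcasting `m`.
    have recv_case : ∀ u' m'', u' < b → R.step u' = some (j, .recv m'' c) →
        c ∈ R.known i t := by
      intro u' m'' hu' hc'
      obtain ⟨w, hw, hw'⟩ := R.broadcast.causality j m'' c u' m b hc' hj hu' i s h
      exact ⟨w, by omega, Or.inl ⟨_, hw'⟩⟩
    rcases (Nat.lt_succ_iff_lt_or_eq.1 hu) with hub | rfl
    · obtain ⟨u', m'', hu', hc'⟩ :=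
        R.exists_recv_of_mem_known ⟨u, hub, hc⟩ hj (by simp) (by simp)
      exact recv_case u' m'' hu' hc'
    · rcases hc with ⟨m'', hc⟩ | ⟨rfl, -⟩
      · rw [hj] at hc
        simp at hc
      · exact ⟨s, hs, Or.inl ⟨_, h⟩⟩
  · obtain rfl : i = j := by
      rw [hj] at h
      simp at h
      exact h.1.symm
    exact R.known_mono i hs

/-! ## The causal order -/

/-- The messages known at the commit point of an event, including its own message. -/
def causalPast (e : R.Event) : Set ℕ := R.known e.pid (R.commit e + 1)

theorem finite_causalPast (e : R.Event) : (R.causalPast e).Finite := R.finite_known _ _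

/-- A known instant is that of a broadcast, here made by the process of `e`, so causal delivery
applies to its message. -/
theorem causalPast_subset_known {e : R.Event} {i : Fin n} {t : ℕ} (h : R.commit e ∈ R.known i t) :
    R.causalPast e ⊆ R.known i t := by
  obtain ⟨s, hs, ⟨m, hm⟩ | ⟨rfl, m, hm⟩⟩ := id h
  · obtain ⟨-, j, hj⟩ := R.broadcast.validity _ _ _ _ hm
    obtain ⟨a, ha, -⟩ := R.exists_step_commit e
    obtain rfl : j = e.pid := by
      rw [hj] at ha
      simp at ha
      exact ha.1
    exact R.known_subset_known h hj
  · obtain ⟨a, ha, -⟩ := R.exists_step_commit e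
    obtain rfl : i = e.pid := by
      rw [hm] at ha
      simp at ha
      exact ha.1
    exact R.known_mono _ hs

/-- Every message in the causal past of an event is received by some process. -/
theorem exists_recv_of_mem_causalPast {e : R.Event} {b : ℕ} (h : b ∈ R.causalPast e) :
    ∃ t j m, R.step t = some (j, .recv m b) := by
  obtain ⟨a, ha, hcrash, hrecv⟩ := R.exists_step_commit e
  obtain ⟨s, hs, hb⟩ := h
  rcases Nat.lt_succ_iff_lt_or_eq.1 hs with hs | rfl
  · obtain ⟨u, m, -, hu⟩ := R.exists_recv_of_mem_known ⟨s, hs, hb⟩ ha hcrash hrecv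
    exact ⟨u, _, m, hu⟩
  · rcases hb with ⟨m, hb⟩ | ⟨rfl, m, hb⟩
    · exact ⟨_, _, m, hb⟩
    -- The message of `e` itself: this is where writes without effect must have been excluded from
    -- the events.
    · rcases (R.isCommit_commit e).kind with ⟨x, v, -, -, j, t, h⟩ | ⟨x, -, ⟨o, h⟩ | ⟨c, h⟩⟩
      · exact ⟨t, j, _, h⟩
      · rw [h] at hb; simp at hb
      · rw [h] at hb; simp at hb

/-- The causal order: an event precedes the later events that know all that it knows. -/
def causalOrder (e e' : R.Event) : Prop :=
  R.causalPast e ⊆ R.causalPast e' ∧ R.commit e ≤ R.commit e'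

/-- A process that crashes makes no later call; any other eventually receives each of the finitely
many messages in the past of `e`. -/
theorem eventually_causalPast_subset (e : R.Event) (j : Fin n) :
    ∀ᶠ t in Filter.atTop, ∀ e' : R.Event, e'.pid = j → t ≤ e'.time →
      R.causalPast e ⊆ R.causalPast e' := by
  by_cases hj : R.step.Faulty j
  · obtain ⟨s, hs⟩ := hj
    filter_upwards [Filter.eventually_gt_atTop s] with t ht e' he' hte'
    exact absurd (he' ▸ e'.is_call) (R.no_call_of_crash hs (ht.trans_le hte') _)
  · have : ∀ᶠ t in Filter.atTop, ∀ b ∈ R.causalPast e, b ∈ R.known j t := by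
      rw [(R.finite_causalPast e).eventually_all]
      intro b hb
      obtain ⟨s, i, m, hs⟩ := R.exists_recv_of_mem_causalPast hb
      obtain ⟨s', hs'⟩ := R.broadcast.agreement s i m b hs j hj
      filter_upwards [Filter.eventually_gt_atTop s'] with t ht
      exact ⟨s', ht, Or.inl ⟨m, hs'⟩⟩
    filter_upwards [this] with t ht e' he' hte'
    subst he'
    exact fun b hb => R.known_mono _ (by have := (R.isCommit_commit e').le; omega) (ht b hb)

theorem isCausalOrder_causalOrder : R.history.IsCausalOrder R.causalOrder where
  refl _ := ⟨subset_rfl, le_rfl⟩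
  trans _ _ _ h h' := ⟨h.1.trans h'.1, h.2.trans h'.2⟩
  antisymm _ _ h h' := R.commit_injective (le_antisymm h.2 h'.2)
  contains_po := by
    rintro e e' ⟨hp, ht⟩
    rcases ht.lt_or_eq with ht | ht
    · have h := R.commit_lt_commit hp ht
      refine ⟨?_, h.le⟩
      change R.known e.pid _ ⊆ R.known e'.pid _
      rw [hp]
      exact R.known_mono _ (by omega)
    · obtain rfl := Event.eq_of_time ht
      exact ⟨subset_rfl, le_rfl⟩
  cofinite e := by
    -- There are finitely many processes, so one `t` serves all of them; events called after both
    -- `t` and `commit e` then follow `e`.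
    obtain ⟨t, ht⟩ := (Filter.eventually_all.2 (R.eventually_causalPast_subset e)).exists
    refine Set.Finite.subset ((Set.finite_Iio (max t (R.commit e))).preimage
      (f := fun e' : R.Event => e'.time) fun _ _ _ _ h => Event.eq_of_time h) ?_
    intro e' he'
    by_contra hlt
    simp only [Set.mem_preimage, Set.mem_Iio, not_lt, max_le_iff] at hlt
    exact he' ⟨ht _ e' rfl hlt.1, hlt.2.trans (R.isCommit_commit e').le⟩

/-! ## Local variables as the effect of the received messages -/

/-- The effect of the message broadcast at instant `b`, if there is one. -/
def applyMsg (str : Fin K → Fin k → ℕ) (b : ℕ) : Fin K → Fin k → ℕ :=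
  match R.step b with
  | some (_, .bcast m) => onReceive str m
  | _ => str

theorem applyMsg_of_bcast {str : Fin K → Fin k → ℕ} {b : ℕ} {i : Fin n} {m : Msg K}
    (h : R.step b = some (i, .bcast m)) : R.applyMsg str b = onReceive str m := by
  simp [applyMsg, h]

theorem applyMsg_of_not_bcast {str : Fin K → Fin k → ℕ} {b : ℕ}
    (h : ∀ i m, R.step b ≠ some (i, .bcast m)) : R.applyMsg str b = str := by
  unfold applyMsg
  split
  · exact absurd ‹_› (h _ _)
  · rfl

/-- The effect of an event on the data type is that of the message broadcast at its commit point. -/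
theorem next_input (q : Fin K → Fin k → ℕ) (e : R.Event) :
    ((windowStream k).array K).next q e.input = R.applyMsg q (R.commit e) := by
  rcases (R.isCommit_commit e).kind with ⟨x, v, hin, h, -⟩ | ⟨x, hin, h⟩
  · rw [R.applyMsg_of_bcast h, onReceive_eq_next, hin]
  · rw [R.applyMsg_of_not_bcast, hin]
    · exact Function.update_eq_self _ _
    · intro i m h'
      rcases h with ⟨o, h⟩ | ⟨c, h⟩ <;> rw [h'] at h <;> simp at h

/-- The messages received by process `i` before instant `t`, in the order of receipt. -/
def received (i : Fin n) : ℕ → List ℕ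
  | 0 => []
  | t + 1 => match R.step t with
    | some (j, .recv _ b) => if j = i then received i t ++ [b] else received i t
    | _ => received i t

theorem received_succ_of_recv {i : Fin n} {t b : ℕ} {m : Msg K}
    (h : R.step t = some (i, .recv m b)) : R.received i (t + 1) = R.received i t ++ [b] := by
  simp [received, h]

theorem received_succ_of_not_recv {i : Fin n} {t : ℕ}
    (h : ∀ m b, R.step t ≠ some (i, .recv m b)) : R.received i (t + 1) = R.received i t := by
  rw [received]
  split
  · rename_i j m b hs
    rw [if_neg]
    rintro rfl
    exact h m b hs
  · rfl

theorem mem_received {i : Fin n} {t b : ℕ} :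
    b ∈ R.received i t ↔ ∃ s m, s < t ∧ R.step s = some (i, .recv m b) := by
  induction t with
  | zero => simp [received]
  | succ t ih =>
    by_cases h : ∃ m b', R.step t = some (i, .recv m b')
    · obtain ⟨m, b', h⟩ := h
      rw [R.received_succ_of_recv h, List.mem_append, ih, List.mem_singleton]
      constructor
      · rintro (⟨s, m', hs, hb⟩ | rfl)
        · exact ⟨s, m', by omega, hb⟩
        · exact ⟨t, m, by omega, h⟩
      · rintro ⟨s, m', hs, hb⟩
        rcases Nat.lt_succ_iff_lt_or_eq.1 hs with hs | rfl
        · exact Or.inl ⟨s, m', hs, hb⟩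
        · rw [h] at hb
          simp at hb
          exact Or.inr hb.2.symm
    · push Not at h
      rw [R.received_succ_of_not_recv h, ih]
      constructor
      · rintro ⟨s, m', hs, hb⟩
        exact ⟨s, m', by omega, hb⟩
      · rintro ⟨s, m', hs, hb⟩
        rcases Nat.lt_succ_iff_lt_or_eq.1 hs with hs | rfl
        · exact ⟨s, m', hs, hb⟩
        · exact absurd hb (h _ _)

/-- Process `i` receives the message broadcast at `b` before the one broadcast at `b'`. -/
def ReceivedBefore (i : Fin n) (b b' : ℕ) : Prop :=
  ∃ s s' m m', s < s' ∧ R.step s = some (i, .recv m b) ∧ R.step s' = some (i, .recv m' b')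

/-- Irreflexivity and antisymmetry make a list sorted by order of receipt determined by its members,
as needed in `foldl_next_eq_str`. -/
instance (i : Fin n) : Std.Irrefl (R.ReceivedBefore i) where
  irrefl := by
    rintro b ⟨s, s', m, m', hlt, h, h'⟩
    exact hlt.ne (R.broadcast.no_duplication _ _ _ _ _ _ h h')

theorem ReceivedBefore.asymm {R : Run n K k} {i : Fin n} {b b' : ℕ}
    (h : R.ReceivedBefore i b b') : ¬ R.ReceivedBefore i b' b := by
  rintro ⟨u', u, l', l, hu, hu1, hu2⟩
  obtain ⟨s, s', m, m', hs, h1, h2⟩ := h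
  have := R.broadcast.no_duplication _ _ _ _ _ _ hu1 h2
  have := R.broadcast.no_duplication _ _ _ _ _ _ hu2 h1
  omega

instance (i : Fin n) : Std.Antisymm (R.ReceivedBefore i) where
  antisymm _ _ h h' := absurd h' h.asymm

theorem pairwise_received (i : Fin n) (t : ℕ) :
    (R.received i t).Pairwise (R.ReceivedBefore i) := by
  induction t with
  | zero => exact List.Pairwise.nil
  | succ t ih =>
    by_cases h : ∃ m b', R.step t = some (i, .recv m b')
    · obtain ⟨m, b', h⟩ := h
      rw [R.received_succ_of_recv h, List.pairwise_append]
      refine ⟨ih, List.pairwise_singleton _ _, fun b hb c hc => ?_⟩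
      obtain rfl := List.mem_singleton.1 hc
      obtain ⟨s, m', hs, hb⟩ := R.mem_received.1 hb
      exact ⟨s, t, m', m, hs, hb, h⟩
    · push Not at h
      rwa [R.received_succ_of_not_recv h]

/-- Only receipts change `str`, and by validity a received message is the one broadcast at the
instant that names it. -/
theorem str_eq_foldl_received (i : Fin n) (t : ℕ) :
    (R.state t i).str = (R.received i t).foldl R.applyMsg fun _ _ => 0 := by
  induction t with
  | zero => rw [R.init]; rfl
  | succ t ih =>
    by_cases h : ∃ a, R.step t = some (i, a)
    · obtain ⟨a, ha⟩ := h
      by_cases hr : ∃ m b, a = .recv m b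
      · obtain ⟨m, b, rfl⟩ := hr
        obtain ⟨-, j, hj⟩ := R.broadcast.validity _ _ _ _ ha
        rw [R.received_succ_of_recv ha, List.foldl_append, ← ih, List.foldl_cons, List.foldl_nil,
          R.applyMsg_of_bcast hj]
        have L := R.acts _ _ _ ha
        generalize R.state t i = A at L
        generalize R.state (t + 1) i = B at L
        cases L
        rfl
      · push Not at hr
        rw [R.received_succ_of_not_recv (fun m b h => hr m b (by rw [ha] at h; simpa using h)), ← ih]
        have L := R.acts _ _ _ ha
        generalize R.state t i = A at L
        generalize R.state (t + 1) i = B at L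
        cases L <;> first | rfl | exact absurd rfl (hr _ _)
    · push Not at h
      rw [R.frame t i h, R.received_succ_of_not_recv (fun m b => h _), ih]

end Run

theorem exists_list_pairwise_lt {α β : Type} [Finite α] [LinearOrder β] (f : α → β)
    (hf : Function.Injective f) :
    ∃ l : List α, (∀ a, a ∈ l) ∧ l.Pairwise fun a b => f a < f b := by
  let := LinearOrder.lift' f hf
  have := Fintype.ofFinite α
  exact ⟨Finset.univ.sort, by simp, Finset.univ.sortedLT_sort.pairwise⟩

namespace Run

variable {n K k : ℕ} (R : Run n K k)

/-! ## The order of the events as seen by a process -/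

/-- The instant from which process `i` knows the causal past of an event. -/
noncomputable def rank (i : Fin n) (e : R.Event) : ℕ := sInf {t | R.causalPast e ⊆ R.known i t}

/-- The events are listed by process `i` in the order in which it learns their causal pasts. -/
noncomputable def key (i : Fin n) (e : R.Event) : ℕ ×ₗ ℕ := toLex (R.rank i e, R.commit e)

theorem key_injective (i : Fin n) : Function.Injective (R.key i) := fun _ _ h =>
  R.commit_injective (congrArg (fun x => (ofLex x).2) h)

theorem rank_le_of_key_lt {i : Fin n} {e e' : R.Event} (h : R.key i e < R.key i e') :
    R.rank i e ≤ R.rank i e' := by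
  rcases Prod.Lex.toLex_lt_toLex.1 h with h | h
  · exact h.le
  · exact h.1.le

/-- The hypothesis rules out the infimum of the empty set, which would give rank `0`. -/
theorem causalPast_subset_known_rank {i : Fin n} {e : R.Event}
    (h : ∃ t, R.causalPast e ⊆ R.known i t) : R.causalPast e ⊆ R.known i (R.rank i e) :=
  Nat.sInf_mem (s := {t | R.causalPast e ⊆ R.known i t}) h

theorem rank_le {i : Fin n} {e : R.Event} {t : ℕ} (h : R.causalPast e ⊆ R.known i t) :
    R.rank i e ≤ t := Nat.sInf_le h

/-- A smaller past is known no later, and ties are settled by commit points, which the causal order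
respects. -/
theorem key_le_of_causalOrder {i : Fin n} {e e' : R.Event} (h : R.causalOrder e e')
    (h' : ∃ t, R.causalPast e' ⊆ R.known i t) : R.key i e ≤ R.key i e' := by
  have h1 : R.rank i e ≤ R.rank i e' :=
    R.rank_le (h.1.trans (R.causalPast_subset_known_rank h'))
  rcases h1.lt_or_eq with h1 | h1
  · exact (Prod.Lex.toLex_lt_toLex.2 (Or.inl h1)).le
  · exact Prod.Lex.toLex_le_toLex.2 (Or.inr ⟨h1, h.2⟩)

/-- An event whose message is known to a process precedes the next event of this process. -/
theorem causalOrder_of_mem_known {e f : R.Event} (h : R.commit e ∈ R.known f.pid (R.commit f)) :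
    R.causalOrder e f :=
  ⟨(R.causalPast_subset_known h).trans (R.known_mono _ (Nat.le_succ _)), (lt_of_mem_known h).le⟩

/-- Holds because a broadcast already counts as learning: the sender receives its own message only
after the commit point. -/
theorem commit_mem_causalPast {e : R.Event} {i : Fin n} {m : Msg K}
    (h : R.step (R.commit e) = some (i, .bcast m)) : R.commit e ∈ R.causalPast e := by
  obtain ⟨a, ha, -⟩ := R.exists_step_commit e
  obtain rfl : i = e.pid := by
    rw [h] at ha
    simp at ha
    exact ha.1
  exact ⟨_, Nat.lt_succ_self _, Or.inr ⟨rfl, m, h⟩⟩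

/-- A process lists two writes in the order in which it receives their messages. -/
theorem key_lt_of_receivedBefore {i : Fin n} {e e' : R.Event}
    (h : R.ReceivedBefore i (R.commit e) (R.commit e'))
    (h' : ∃ t, R.causalPast e' ⊆ R.known i t) : R.key i e < R.key i e' := by
  obtain ⟨s, s', m, m', hss, hs, hs'⟩ := h
  obtain ⟨-, j, hj⟩ := R.broadcast.validity _ _ _ _ hs'
  obtain ⟨u, hu, hlearn⟩ := R.causalPast_subset_known_rank h' (R.commit_mem_causalPast hj)
  -- Either `u = s'`, or `i` sent the message of `e'` at `u`; in the latter case `i` can receive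
  -- nothing else between `u` and `s'`.
  have hsu : s < u := by
    rcases hlearn with ⟨m'', h⟩ | ⟨rfl, m'', h⟩
    · rwa [R.broadcast.no_duplication _ _ _ _ _ _ h hs']
    · by_contra hlt
      rcases (not_lt.1 hlt).lt_or_eq with hlt | heq
      · obtain ⟨w, -, hw, hw'⟩ := R.exists_recv_of_bcast h hlt hs (by simp)
        have := R.broadcast.no_duplication _ _ _ _ _ _ hw' hs'
        omega
      · rw [heq, hs] at h
        simp at h
  have h1 : R.rank i e ≤ u := R.rank_le (R.causalPast_subset_known ⟨s, hsu, Or.inl ⟨m, hs⟩⟩)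
  exact Prod.Lex.toLex_lt_toLex.2 (Or.inl (h1.trans_lt hu))

/-- A read returns the state of the data type after the events listed before it. -/
theorem foldl_next_eq_str {f : R.Event} {o : Option (Fin k → ℕ)}
    (hf : R.step (R.commit f) = some (f.pid, .ret o)) (l : List R.Event)
    (hpw : l.Pairwise fun a b => R.key f.pid a < R.key f.pid b)
    (hmem : ∀ g, R.commit g ∈ R.known f.pid (R.commit f) → g ∈ l)
    (hlt : ∀ g ∈ l, R.key f.pid g < R.key f.pid f)
    (hknown : ∀ g ∈ l, ∃ t, R.causalPast g ⊆ R.known f.pid t) :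
    (l.map Event.input).foldl ((windowStream k).array K).next ((windowStream k).array K).init =
      (R.state (R.commit f) f.pid).str := by
  classical
  -- Commit points of reads have no effect on the state and are filtered out.
  let isBcast : ℕ → Bool := fun b => decide (∃ i m, R.step b = some (i, .bcast m))
  have hfold : ∀ (l : List ℕ) (q : Fin K → Fin k → ℕ),
      l.foldl R.applyMsg q = (l.filter isBcast).foldl R.applyMsg q := by
    intro l
    induction l with
    | nil => intro q; rfl
    | cons b l ih =>
      intro q
      by_cases hb : ∃ i m, R.step b = some (i, .bcast m)
      · rw [List.filter_cons_of_pos (by simpa [isBcast] using hb), List.foldl_cons, List.foldl_cons,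
          ih]
      · rw [List.filter_cons_of_neg (by simpa [isBcast] using hb), List.foldl_cons,
          R.applyMsg_of_not_bcast (fun i m h => hb ⟨i, m, h⟩), ih]
  have hnext : ∀ (l : List R.Event) (q : Fin K → Fin k → ℕ),
      (l.map Event.input).foldl ((windowStream k).array K).next q =
        (l.map R.commit).foldl R.applyMsg q := by
    intro l
    induction l with
    | nil => intro q; rfl
    | cons g l ih =>
      intro q
      exact (congrArg (fun q' => (l.map Event.input).foldl ((windowStream k).array K).next q')
        (R.next_input q g)).trans (ih _)
  -- The commit step is a return and teaches nothing, so the `+ 1` in `causalPast` can be dropped.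
  have hpast : R.causalPast f ⊆ R.known f.pid (R.commit f) := by
    rintro b ⟨s, hs, hb⟩
    rcases Nat.lt_succ_iff_lt_or_eq.1 hs with hs | rfl
    · exact ⟨s, hs, hb⟩
    · rcases hb with ⟨m, hb⟩ | ⟨rfl, m, hb⟩ <;> rw [hf] at hb <;> simp at hb
  have hrecv : ∀ b, b ∈ R.known f.pid (R.commit f) ↔ b ∈ R.received f.pid (R.commit f) := by
    intro b
    rw [R.mem_received]
    exact ⟨fun h => R.exists_recv_of_mem_known h hf (by simp) (by simp),
      fun ⟨s, m, hs, h⟩ => ⟨s, hs, Or.inl ⟨m, h⟩⟩⟩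
  -- A write listed before `f` has rank at most that of `f`, hence at most `commit f`.
  have hwrite : ∀ g ∈ l, isBcast (R.commit g) → R.commit g ∈ R.received f.pid (R.commit f) := by
    intro g hg hb
    obtain ⟨i, m, hb⟩ := of_decide_eq_true hb
    rw [← hrecv]
    exact R.known_mono _ ((R.rank_le_of_key_lt (hlt g hg)).trans (R.rank_le hpast))
      (R.causalPast_subset_known_rank (hknown g hg) (R.commit_mem_causalPast hb))
  refine (hnext l _).trans ((hfold _ _).trans ?_)
  rw [R.str_eq_foldl_received]
  have heq : (l.map R.commit).filter isBcast = R.received f.pid (R.commit f) := by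
    refine List.Pairwise.eq_of_mem_iff (r := R.ReceivedBefore f.pid) ?_ (R.pairwise_received _ _) ?_
    · rw [List.pairwise_filter, List.pairwise_map]
      refine hpw.imp_of_mem fun {g g'} hg hg' hlt hb hb' => ?_
      obtain ⟨s, m, -, hs⟩ := R.mem_received.1 (hwrite g hg hb)
      obtain ⟨s', m', -, hs'⟩ := R.mem_received.1 (hwrite g' hg' hb')
      rcases lt_trichotomy s s' with h | rfl | h
      · exact ⟨s, s', m, m', h, hs, hs'⟩
      · rw [hs] at hs'
        simp only [Option.some.injEq, Prod.mk.injEq, Action.recv.injEq, true_and] at hs'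
        rw [R.commit_injective hs'.2] at hlt
        exact absurd hlt (lt_irrefl _)
      · exact absurd (R.key_lt_of_receivedBefore ⟨s', s, m', m, h, hs', hs⟩ (hknown g hg)) hlt.asymm
    · intro b
      rw [List.mem_filter, List.mem_map]
      constructor
      · rintro ⟨⟨g, hg, rfl⟩, hb⟩
        exact hwrite g hg hb
      · intro hb
        obtain ⟨s, m, hs, hm⟩ := R.mem_received.1 hb
        obtain ⟨g, rfl⟩ := R.exists_event_of_recv hm
        obtain ⟨-, j, hj⟩ := R.broadcast.validity _ _ _ _ hm
        exact ⟨⟨g, hmem g ((hrecv _).2 hb), rfl⟩, decide_eq_true ⟨j, m, hj⟩⟩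
  rw [heq]
  rfl

/-! ## Causal consistency -/

theorem label_of_returns {e : R.Event} {o : Option (Fin k → ℕ)}
    (h : R.Returns e.pid e.time o) : R.history.label e = .full e.input o := by
  have h' : ∃ o, R.Returns e.pid e.time o := ⟨o, h⟩
  rw [h.unique h'.choose_spec]
  exact dif_pos h'

theorem label_of_not_returns {e : R.Event} (h : ¬ ∃ o, R.Returns e.pid e.time o) :
    R.history.label e = .hidden e.input :=
  dif_neg h

/-- A list of the causal past of `e`, in the order in which the process of `e` learns it, agrees with
the outputs of the data type. -/
theorem label_agrees (e : R.Event) (p : Set R.Event) (hp : ∀ f ∈ p, f.pid = e.pid)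
    (l₁ : List {g | R.causalOrder g e}) (f : {g | R.causalOrder g e})
    (l₂ : List {g | R.causalOrder g e}) (hmem : ∀ g, g ∈ l₁ ++ f :: l₂)
    (hpw : (l₁ ++ f :: l₂).Pairwise fun a b => R.key e.pid a.1 < R.key e.pid b.1) :
    ((R.history.withOrder _ R.isCausalOrder_causalOrder).proj {g | R.causalOrder g e} p).label f =
        .hidden f.1.input ∨
      ((R.history.withOrder _ R.isCausalOrder_causalOrder).proj {g | R.causalOrder g e} p).label f =
        .full f.1.input (((windowStream k).array K).out
          ((l₁.map fun g => g.1.input).foldl ((windowStream k).array K).next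
            ((windowStream k).array K).init) f.1.input) := by
  have hknown : ∀ g : {g | R.causalOrder g e}, ∃ t, R.causalPast g.1 ⊆ R.known e.pid t :=
    fun g => ⟨_, g.2.1⟩
  by_cases hfp : f.1 ∈ p
  swap
  · refine Or.inl ((if_neg hfp).trans ?_)
    change (R.history.label f.1).hide = _
    by_cases hret : ∃ o, R.Returns f.1.pid f.1.time o
    · obtain ⟨o, ho⟩ := hret
      rw [R.label_of_returns ho]
      rfl
    · rw [R.label_of_not_returns hret]
      rfl
  by_cases hret : ∃ o, R.Returns f.1.pid f.1.time o
  swap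
  · exact Or.inl ((if_pos hfp).trans (R.label_of_not_returns hret))
  obtain ⟨o, ho⟩ := hret
  refine Or.inr ((if_pos hfp).trans ((R.label_of_returns ho).trans (congrArg _ ?_)))
  rcases (R.isCommit_commit f.1).returns _ ho with ⟨x, hin, hstep, ho⟩ | ⟨⟨x, v, hin⟩, ho⟩
  · have hf := hp f.1 hfp
    rw [List.pairwise_append] at hpw
    obtain ⟨hpw₁, hpw₂, hlt⟩ := hpw
    have hstr := R.foldl_next_eq_str hstep (l₁.map Subtype.val)
      (by rw [List.pairwise_map, hf]; exact hpw₁)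
      (by
        intro g hg
        -- What is known before the read returns is causally before it, hence in the past of `e`;
        -- increasing keys then force it into `l₁`.
        have hgf := R.causalOrder_of_mem_known hg
        have hgA : R.causalOrder g e := R.isCausalOrder_causalOrder.trans _ _ _ hgf f.2
        refine List.mem_map.2
          ⟨⟨g, hgA⟩, (List.mem_append.1 (hmem ⟨g, hgA⟩)).resolve_right fun hmem => ?_, rfl⟩
        rcases List.mem_cons.1 hmem with h | h
        · rw [show g = f.1 from congrArg Subtype.val h] at hg
          exact (lt_of_mem_known hg).false
        · exact ((List.pairwise_cons.1 hpw₂).1 _ h).not_ge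
            (R.key_le_of_causalOrder hgf (hknown f)))
      (by
        intro g hg
        obtain ⟨g, hgl, rfl⟩ := List.mem_map.1 hg
        rw [hf]
        exact hlt g hgl f List.mem_cons_self)
      (by
        intro g hg
        obtain ⟨g, hgl, rfl⟩ := List.mem_map.1 hg
        rw [hf]
        exact hknown g)
    rw [List.map_map] at hstr
    rw [ho, hin]
    exact congrArg (fun q : Fin K → Fin k → ℕ => some (q x)) hstr.symm
  · rw [ho, hin]
    rfl

/-- The history of an execution is causally consistent. -/
theorem history_mem_CC : R.history ∈ CC ((windowStream k).array K) := by
  refine ⟨R.causalOrder, R.isCausalOrder_causalOrder, fun p hp (e : R.Event) he => ?_⟩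
  -- Comparable calls belong to one process, so the visible outputs are all those of the process of
  -- `e`.
  have hpid : ∀ f : R.Event, f ∈ p → f.pid = e.pid := by
    intro f hf
    by_cases hfe : f = e
    · rw [hfe]
    · rcases hp.1 hf he hfe with h | h
      · exact h.1
      · exact h.1.symm
  have hfin : Finite {g | R.causalOrder g e} :=
    (R.isCausalOrder_causalOrder.finite_past e).to_subtype
  obtain ⟨l, hl, hpw⟩ := exists_list_pairwise_lt
    (fun g : {g | R.causalOrder g e} => R.key e.pid g.1)
    ((R.key_injective _).comp Subtype.val_injective)
  refine lin_inter_seqSpec_nonempty _ _ l (fun g => Event.input g.1) e.input hl ?_ ?_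
  · exact hpw.imp fun {a b} h h' => h.not_ge (R.key_le_of_causalOrder h' ⟨_, a.2.1⟩)
  · rintro l₁ f l₂ rfl
    exact R.label_agrees e p hpid l₁ f l₂ hl hpw

end Run
end CausalConsistency

theorem mainTheorem6 (n K k : ℕ) :
    CausalConsistency.admitted n K k ⊆
      CausalConsistency.CC ((CausalConsistency.windowStream k).array K) := by
  rintro _ ⟨R, rfl⟩
  exact R.history_mem_CC
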